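/- \textbf{Theorem.} Let $F$ be Thompson's group: the group, under composition, of all orientation-preserving piecewise linear homeomorphisms of $[0,1]$ with finitely many breakpoints, all having dyadic rational coordinates, and with all slopes powers of $2$. A \emph{tree pair} of size $n\ge 1$ is an ordered pair $(S,T)$ of finite rooted binary trees, each with $n$ carets (internal vertices); it is \emph{reduced} if $n=1$, or if $n\ge 2$ and, numbering the leaves of each tree from left to right, there is no $j$ such that both trees contain a caret whose two children are the leaves $j$ and $j+1$. A binary tree describes a subdivision of $[0,1]$ into dyadic intervals, one for each leaf (each caret halves an interval), and $(S,T)$ represents the element of $F$ that maps the $j$-th interval of $S$ affinely onto the $j$-th interval of $T$ for every $j$. For $k\ge1$ let $X_k$ be the set of unordered $k$-tuples (with repetition allowed) of reduced tree pairs, and let $\mathrm{Sph}^{\max}_k(n)\subset X_k$ be the finite set of those $k$-tuples in which the maximum of the sizes of the components is $n$. A set $A\subseteq X_k$ has density $d$ if \[\lim_{n\to\infty}\frac{|A\cap \mathrm{Sph}^{\max}_k(n)|}{|\mathrm{Sph}^{\max}_k(n)|}=d .\] Let $\mathrm{Spec}^{\max}_k(F)$ be the set of isomorphism classes of subgroups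 $H$ of $F$ such that the set of $k$-tuples generating a subgroup of $F$ isomorphic to $H$ has a density and this density is positive. Then \[\mathrm{Spec}^{\max}_1(F)=\{\mathbb Z\},\] and for every $k\ge 2$ one has $\mathbb Z\notin \mathrm{Spec}^{\max}_k(F)$; more precisely, the set of $k$-tuples generating a subgroup isomorphic to $\mathbb Z$ has density $0$. -/

import Mathlib

open Filter Topology

noncomputable section

namespace ThompsonF

/-! ### Thompson's group `F` as a group of piecewise linear homeomorphisms of `[0,1]` -/

/-- The unit interval `[0,1]`. -/
abbrev I : Type := Set.Icc (0 : ℝ) 1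

/-- Dyadic rationals. -/
def IsDyadic (x : ℝ) : Prop := ∃ (a : ℤ) (m : ℕ), x = a / 2 ^ m

/-- `f` is piecewise linear with finitely many breakpoints (contained in `B`), all breakpoints
have dyadic coordinates, and on every interval without breakpoints in its interior `f` is affine
with slope a power of two. -/
def IsDyadicPL (f : I ≃o I) : Prop :=
  ∃ B : Finset I, (∀ b ∈ B, IsDyadic (b : ℝ) ∧ IsDyadic (f b : ℝ)) ∧
    ∀ u v : I, u ≤ v → (∀ b ∈ B, ¬ (u < b ∧ b < v)) →
      ∃ k : ℤ, ∀ x : I, u ≤ x → x ≤ v → (f x : ℝ) - f u = (2 : ℝ) ^ k * ((x : ℝ) - u)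

theorem IsDyadic.sub {x y : ℝ} (hx : IsDyadic x) (hy : IsDyadic y) : IsDyadic (x - y) := by
  obtain ⟨a, m, rfl⟩ := hx
  obtain ⟨b, n, rfl⟩ := hy
  refine ⟨a * 2 ^ n - b * 2 ^ m, m + n, ?_⟩
  push_cast
  rw [pow_add]
  field_simp

theorem IsDyadic.add {x y : ℝ} (hx : IsDyadic x) (hy : IsDyadic y) : IsDyadic (x + y) := by
  obtain ⟨a, m, rfl⟩ := hx
  obtain ⟨b, n, rfl⟩ := hy
  refine ⟨a * 2 ^ n + b * 2 ^ m, m + n, ?_⟩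
  push_cast
  rw [pow_add]
  field_simp

theorem IsDyadic.zpow_mul {x : ℝ} (hx : IsDyadic x) (k : ℤ) : IsDyadic ((2 : ℝ) ^ k * x) := by
  obtain ⟨a, m, rfl⟩ := hx
  obtain ⟨n, rfl | rfl⟩ := k.eq_nat_or_neg
  · refine ⟨a * 2 ^ n, m, ?_⟩
    push_cast
    rw [zpow_natCast]
    ring
  · refine ⟨a, m + n, ?_⟩
    rw [zpow_neg, zpow_natCast, pow_add]
    field_simp

theorem isDyadic_zero : IsDyadic 0 := ⟨0, 0, by simp⟩

theorem isDyadic_natCast (n : ℕ) : IsDyadic n := ⟨n, 0, by simp⟩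

/-- Elements of `F` preserve dyadic points, in both directions. -/
theorem IsDyadicPL.isDyadic_iff {f : I ≃o I} (hf : IsDyadicPL f) (x : I) :
    IsDyadic (f x : ℝ) ↔ IsDyadic (x : ℝ) := by
  obtain ⟨B, hB, hlin⟩ := hf
  have h0 : IsDyadic ((⊥ : I) : ℝ) ∧ IsDyadic (f ⊥ : ℝ) := by
    rw [OrderIso.map_bot f]
    exact ⟨isDyadic_zero, isDyadic_zero⟩
  obtain ⟨u, hu, hmax⟩ := ((insert ⊥ B).filter (fun b => b ≤ x)).exists_max_image id
    ⟨⊥, by simp⟩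
  simp only [Finset.mem_filter, Finset.mem_insert, id] at hu hmax
  have hdu : IsDyadic (u : ℝ) ∧ IsDyadic (f u : ℝ) := by
    rcases hu.1 with rfl | h
    · exact h0
    · exact hB u h
  obtain ⟨k, hk⟩ := hlin u x hu.2 (fun b hb h =>
    absurd (hmax b ⟨Or.inr hb, h.2.le⟩) (not_le.2 h.1))
  have hx := hk x hu.2 le_rfl
  constructor
  · intro h
    have h1 := ((h.sub hdu.2).zpow_mul (-k)).add hdu.1
    rw [hx, ← mul_assoc, ← zpow_add₀ (by norm_num : (2 : ℝ) ≠ 0)] at h1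
    simpa using h1
  · intro h
    have h1 := ((h.sub hdu.1).zpow_mul k).add hdu.2
    rw [← hx] at h1
    simpa using h1

/-- Thompson's group `F`: the group (under composition) of all orientation-preserving
piecewise linear homeomorphisms of `[0,1]` whose breakpoints have dyadic coordinates and whose
slopes are powers of two. -/
def F : Subgroup (I ≃o I) where
  carrier := {f | IsDyadicPL f}
  one_mem' := ⟨∅, by simp, fun u v _ _ => ⟨0, fun x _ _ => by simp⟩⟩
  mul_mem' := by
    classical
    intro f g hf hg
    have hfd := hf.isDyadic_iff
    have hgd := hg.isDyadic_iff
    obtain ⟨B, hB, hl⟩ := hf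
    obtain ⟨C, hC, hm⟩ := hg
    refine ⟨C ∪ B.image g.symm, ?_, ?_⟩
    · intro b hb
      have hb' : IsDyadic (b : ℝ) := by
        rcases Finset.mem_union.1 hb with h | h
        · exact (hC b h).1
        · obtain ⟨c, hc, rfl⟩ := Finset.mem_image.1 h
          rw [← hgd, OrderIso.apply_symm_apply]
          exact (hB c hc).1
      refine ⟨hb', ?_⟩
      rw [RelIso.mul_apply]
      exact (hfd _).2 ((hgd _).2 hb')
    · intro u v huv h
      obtain ⟨k, hk⟩ := hm u v huv (fun b hb => h b (Finset.mem_union_left _ hb))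
      obtain ⟨l, hl⟩ := hl (g u) (g v) (g.monotone huv) (by
        intro b hb hbb
        refine h (g.symm b) (Finset.mem_union_right _ (Finset.mem_image_of_mem _ hb)) ⟨?_, ?_⟩
        · exact g.lt_symm_apply.2 hbb.1
        · exact g.symm_apply_lt.2 hbb.2)
      refine ⟨l + k, fun x hx hx' => ?_⟩
      rw [RelIso.mul_apply, RelIso.mul_apply, hl (g x) (g.monotone hx) (g.monotone hx'),
        hk x hx hx', zpow_add₀ (by norm_num), mul_assoc]
  inv_mem' := by
    classical
    intro f hf
    obtain ⟨B, hB, hl⟩ := hf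
    refine ⟨B.image f, ?_, ?_⟩
    · intro b hb
      obtain ⟨c, hc, rfl⟩ := Finset.mem_image.1 hb
      rw [RelIso.inv_apply_self]
      exact (hB c hc).symm
    · intro u v huv h
      obtain ⟨k, hk⟩ := hl (f.symm u) (f.symm v) (f.symm.monotone huv) (by
        intro b hb hbb
        exact h (f b) (Finset.mem_image_of_mem _ hb)
          ⟨f.symm_apply_lt.1 hbb.1, f.lt_symm_apply.1 hbb.2⟩)
      refine ⟨-k, fun x hx hx' => ?_⟩
      have h1 := hk (f.symm x) (f.symm.monotone hx) (f.symm.monotone hx')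
      rw [OrderIso.apply_symm_apply, OrderIso.apply_symm_apply] at h1
      change ((f.symm x : I) : ℝ) - (f.symm u : I) = _
      rw [h1, ← mul_assoc, ← zpow_add₀ (by norm_num : (2 : ℝ) ≠ 0)]
      simp

/-! ### Tree pairs -/

/-- Finite rooted (ordered) binary trees: a `node` is a caret, a `nil` is a leaf. -/
abbrev BTree : Type := BinaryTree Unit

/-- The set of numbers `j` such that `T` contains an exposed caret, i.e. a caret both of whose
children are leaves, with leaves numbered `j` and `j + 1`
(leaves are numbered from left to right starting with `0`). -/
def exposed : BTree → Set ℕ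
  | .nil => ∅
  | .node _ l r =>
      {j | l = .nil ∧ r = .nil ∧ j = 0} ∪ exposed l ∪ (fun j => j + l.numLeaves) '' exposed r

/-- A reduced tree pair: two nonempty binary trees with the same number of carets, such that,
unless both trees are single carets, there is no pair of exposed carets, one in each tree, with
identical leaf numbers. -/
structure RedPair where
  dom : BTree
  ran : BTree
  numNodes_eq : dom.numNodes = ran.numNodes
  numNodes_pos : 0 < dom.numNodes
  reduced : 2 ≤ dom.numNodes → Disjoint (exposed dom) (exposed ran)

/-- The size of a reduced tree pair: the number of carets in either tree. -/
def RedPair.size (t : RedPair) : ℕ := t.dom.numNodes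

/-- The piecewise linear map that sends `[j, j + 1]`, for each leaf number `j` of `T`, affinely
onto the dyadic interval of the leaf `j` in the subdivision of `[0,1]` described by `T` (each
caret halves an interval). Outside `[0, T.numLeaves]` it is extended with the slopes of the first
and the last leaf. -/
def leafMap : BTree → ℝ → ℝ
  | .nil, x => x
  | .node _ l r, x =>
      if x ≤ l.numLeaves then leafMap l x / 2 else 1 / 2 + leafMap r (x - l.numLeaves) / 2

/-- The inverse of `leafMap`. -/
def leafInv : BTree → ℝ → ℝ
  | .nil, y => y
  | .node _ l r, y =>
      if y ≤ 1 / 2 then leafInv l (2 * y) else l.numLeaves + leafInv r (2 * y - 1)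

theorem leafMap_zero (T : BTree) : leafMap T 0 = 0 := by
  induction T with
  | nil => rfl
  | node a l r hl hr => simp [leafMap, hl]

theorem leafMap_numLeaves (T : BTree) : leafMap T T.numLeaves = 1 := by
  induction T with
  | nil => simp [leafMap]
  | node a l r hl hr =>
    have : ¬ ((l.numLeaves : ℝ) + r.numLeaves ≤ l.numLeaves) := by
      have : (0 : ℝ) < r.numLeaves := by exact_mod_cast r.numLeaves_pos
      linarith
    simp only [leafMap, BinaryTree.numLeaves, Nat.cast_add, this, if_false, add_sub_cancel_left, hr]
    norm_num

theorem leafMap_strictMono (T : BTree) : StrictMono (leafMap T) := by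
  induction T with
  | nil => exact fun x y h => h
  | node a l r hl hr =>
    intro x y h
    simp only [leafMap]
    split_ifs with h1 h2 h2
    · have := hl h
      linarith
    · have h3 := hl.monotone h1
      have h4 := hr (sub_pos.2 (not_le.1 h2))
      rw [leafMap_numLeaves] at h3
      rw [leafMap_zero] at h4
      linarith
    · linarith
    · have := hr (sub_lt_sub_right h (l.numLeaves : ℝ))
      linarith

theorem leafMap_leafInv (T : BTree) : Function.RightInverse (leafInv T) (leafMap T) := by
  induction T with
  | nil => exact fun x => rfl
  | node a l r hl hr =>
    intro y
    by_cases h : y ≤ 1 / 2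
    · have : leafInv l (2 * y) ≤ l.numLeaves := by
        rw [← (leafMap_strictMono l).le_iff_le, hl, leafMap_numLeaves]
        linarith
      simp only [leafInv, leafMap, h, if_true, this]
      rw [hl]
      ring
    · have : ¬ ((l.numLeaves : ℝ) + leafInv r (2 * y - 1) ≤ l.numLeaves) := by
        have : 0 < leafInv r (2 * y - 1) := by
          rw [← (leafMap_strictMono r).lt_iff_lt, hr, leafMap_zero]
          linarith
        linarith
      simp only [leafInv, leafMap, h, if_false, this, add_sub_cancel_left]
      rw [hr]
      ring

theorem leafInv_leafMap (T : BTree) : Function.LeftInverse (leafInv T) (leafMap T) := fun _ =>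
  (leafMap_strictMono T).injective (leafMap_leafInv T _)

theorem leafInv_strictMono (T : BTree) : StrictMono (leafInv T) := fun x y h => by
  rw [← (leafMap_strictMono T).lt_iff_lt, leafMap_leafInv, leafMap_leafInv]
  exact h

theorem leafMap_affine (T : BTree) :
    ∀ j : ℕ, j < T.numLeaves → ∃ d : ℕ, ∀ x : ℝ, (j : ℝ) ≤ x → x ≤ j + 1 →
      leafMap T x = leafMap T j + (2 : ℝ) ^ (-(d : ℤ)) * (x - j) := by
  induction T with
  | nil =>
    intro j hj
    refine ⟨0, fun x _ _ => ?_⟩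
    simp [leafMap]
  | node a l r hl hr =>
    intro j hj
    have h2 : ∀ d : ℕ, (2 : ℝ) ^ (-((d + 1 : ℕ) : ℤ)) = (2 : ℝ) ^ (-(d : ℤ)) / 2 := by
      intro d
      rw [zpow_neg, zpow_neg, zpow_natCast, zpow_natCast, pow_succ]
      field_simp
    by_cases h : j < l.numLeaves
    · obtain ⟨d, hd⟩ := hl j h
      refine ⟨d + 1, fun x hx hx' => ?_⟩
      have h1 : ((j : ℝ) + 1) ≤ l.numLeaves := by exact_mod_cast h
      simp only [leafMap]
      rw [if_pos (by linarith), if_pos (by linarith), hd x hx hx', h2]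
      ring
    · obtain ⟨i, rfl⟩ := Nat.exists_eq_add_of_le (not_lt.1 h)
      obtain ⟨d, hd⟩ := hr i (by simpa using hj)
      refine ⟨d + 1, fun x hx hx' => ?_⟩
      push_cast at hx hx' ⊢
      have key : ∀ y : ℝ, (l.numLeaves : ℝ) ≤ y →
          leafMap (.node a l r) y = 1 / 2 + leafMap r (y - l.numLeaves) / 2 := by
        intro y hy
        simp only [leafMap]
        split_ifs with h3
        · rw [le_antisymm h3 hy, leafMap_numLeaves, sub_self, leafMap_zero]
          norm_num
        · rfl
      have hi : (0 : ℝ) ≤ i := Nat.cast_nonneg i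
      rw [key _ (by linarith), key _ (by linarith), add_sub_cancel_left,
        hd (x - l.numLeaves) (by linarith) (by linarith)]
      have h3 := h2 d
      push_cast at h3
      rw [h3]
      ring

theorem isDyadic_leafMap (T : BTree) : ∀ j : ℕ, j ≤ T.numLeaves → IsDyadic (leafMap T j) := by
  intro j
  induction j with
  | zero =>
    intro _
    rw [Nat.cast_zero, leafMap_zero]
    exact isDyadic_zero
  | succ j ih =>
    intro hj
    obtain ⟨d, hd⟩ := leafMap_affine T j hj
    rw [Nat.cast_succ, hd _ (by linarith) le_rfl, add_sub_cancel_left]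
    refine (ih (by omega)).add (IsDyadic.zpow_mul ?_ _)
    simpa using isDyadic_natCast 1

theorem RedPair.numLeaves_eq (t : RedPair) : t.dom.numLeaves = t.ran.numLeaves := by
  rw [BinaryTree.numLeaves_eq_numNodes_succ, BinaryTree.numLeaves_eq_numNodes_succ, t.numNodes_eq]

theorem leafMap_leafInv_mem {S T : BTree} (h : S.numLeaves = T.numLeaves) (x : I) :
    leafMap T (leafInv S x) ∈ Set.Icc (0 : ℝ) 1 := by
  have hm := (leafMap_strictMono T).monotone.comp (leafInv_strictMono S).monotone
  have h0 : leafInv S 0 = 0 := by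
    rw [← leafMap_zero S, leafInv_leafMap, leafMap_zero]
  have h1 : leafInv S 1 = S.numLeaves := by
    rw [← leafMap_numLeaves S, leafInv_leafMap]
  constructor
  · have := hm x.2.1
    simpa [h0, leafMap_zero] using this
  · have := hm x.2.2
    simpa [h1, h, leafMap_numLeaves] using this

/-- The homeomorphism of `[0,1]` of a tree pair: for each `j` it maps the interval of leaf `j` of
the first tree affinely onto the interval of leaf `j` of the second tree. -/
def RedPair.toIso (t : RedPair) : I ≃o I where
  toFun x := ⟨leafMap t.ran (leafInv t.dom x), leafMap_leafInv_mem t.numLeaves_eq x⟩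
  invFun x := ⟨leafMap t.dom (leafInv t.ran x), leafMap_leafInv_mem t.numLeaves_eq.symm x⟩
  left_inv x := Subtype.ext (by simp [leafInv_leafMap t.ran _, leafMap_leafInv t.dom _])
  right_inv x := Subtype.ext (by simp [leafInv_leafMap t.dom _, leafMap_leafInv t.ran _])
  map_rel_iff' := by
    intro x y
    exact ((leafMap_strictMono t.ran).comp (leafInv_strictMono t.dom)).le_iff_le

theorem RedPair.isDyadicPL (t : RedPair) : IsDyadicPL t.toIso := by
  classical
  have hS := leafMap_strictMono t.dom
  have hmem : ∀ j : ℕ, j ≤ t.dom.numLeaves → leafMap t.dom j ∈ Set.Icc (0 : ℝ) 1 := by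
    intro j hj
    constructor
    · rw [← leafMap_zero t.dom]
      exact hS.monotone (Nat.cast_nonneg j)
    · rw [← leafMap_numLeaves t.dom]
      exact hS.monotone (by exact_mod_cast hj)
  let p : Fin (t.dom.numLeaves + 1) → I := fun j =>
    ⟨leafMap t.dom (j : ℕ), hmem j (by omega)⟩
  refine ⟨Finset.univ.image p, ?_, ?_⟩
  · intro b hb
    obtain ⟨j, -, rfl⟩ := Finset.mem_image.1 hb
    have hj : (j : ℕ) ≤ t.dom.numLeaves := by omega
    refine ⟨isDyadic_leafMap _ _ hj, ?_⟩
    change IsDyadic (leafMap t.ran (leafInv t.dom (leafMap t.dom (j : ℕ))))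
    rw [leafInv_leafMap]
    exact isDyadic_leafMap _ _ (t.numLeaves_eq ▸ hj)
  · intro u v huv h
    rcases huv.eq_or_lt with rfl | huv'
    · refine ⟨0, fun x hx hx' => ?_⟩
      rw [le_antisymm hx' hx]
      simp
    have hu0 : 0 ≤ leafInv t.dom u := by
      rw [← hS.le_iff_le, leafMap_zero, leafMap_leafInv]
      exact u.2.1
    set j := ⌊leafInv t.dom u⌋₊ with hj
    have hju : (j : ℝ) ≤ leafInv t.dom u := Nat.floor_le hu0
    have huj : leafInv t.dom u < j + 1 := Nat.lt_floor_add_one _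
    have hjn : j < t.dom.numLeaves := by
      have : leafInv t.dom u < t.dom.numLeaves := by
        rw [← hS.lt_iff_lt, leafMap_numLeaves, leafMap_leafInv]
        exact lt_of_lt_of_le huv' v.2.2
      exact_mod_cast lt_of_le_of_lt hju this
    have hvj : leafInv t.dom v ≤ j + 1 := by
      by_contra hcon
      refine h (p ⟨j + 1, by omega⟩) (Finset.mem_image_of_mem _ (Finset.mem_univ _)) ⟨?_, ?_⟩
      · change (u : ℝ) < leafMap t.dom ((j + 1 : ℕ) : ℝ)
        rw [← leafMap_leafInv t.dom u]
        exact hS (by push_cast; exact huj)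
      · change leafMap t.dom ((j + 1 : ℕ) : ℝ) < (v : ℝ)
        rw [← leafMap_leafInv t.dom v]
        exact hS (by push_cast; exact not_le.1 hcon)
    obtain ⟨d, hd⟩ := leafMap_affine t.dom j hjn
    obtain ⟨e, he⟩ := leafMap_affine t.ran j (t.numLeaves_eq ▸ hjn)
    refine ⟨-(e : ℤ) + d, fun x hx hx' => ?_⟩
    have hxu : leafInv t.dom u ≤ leafInv t.dom x := (leafInv_strictMono t.dom).monotone hx
    have hxv : leafInv t.dom x ≤ leafInv t.dom v := (leafInv_strictMono t.dom).monotone hx'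
    have e1 := hd (leafInv t.dom x) (by linarith) (by linarith)
    have e2 := hd (leafInv t.dom u) (by linarith) (by linarith)
    rw [leafMap_leafInv] at e1 e2
    change leafMap t.ran (leafInv t.dom x) - leafMap t.ran (leafInv t.dom u) = _
    rw [he _ (by linarith) (by linarith), he (leafInv t.dom u) (by linarith) (by linarith)]
    have h3 : (2 : ℝ) ^ (d : ℤ) * (2 : ℝ) ^ (-(d : ℤ)) = 1 := by
      rw [← zpow_add₀ (by norm_num : (2 : ℝ) ≠ 0)]
      simp
    rw [zpow_add₀ (by norm_num : (2 : ℝ) ≠ 0)]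
    linear_combination (-(2 : ℝ) ^ (-(e : ℤ)) * (2 : ℝ) ^ (d : ℤ)) * (e1 - e2) -
      ((2 : ℝ) ^ (-(e : ℤ)) * (leafInv t.dom x - leafInv t.dom u)) * h3

/-- The element of `F` represented by a reduced tree pair. -/
def RedPair.toF (t : RedPair) : F := ⟨t.toIso, t.isDyadicPL⟩

/-! ### Unordered tuples, the max stratification, density and the spectrum -/

/-- The set `X_k` of unordered `k`-tuples (multisets of cardinality `k`) of reduced tree pairs. -/
abbrev X (k : ℕ) : Type := Sym RedPair k

/-- The sphere of radius `n` in `X_k` for the max stratification: the `k`-tuples in which the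
maximum of the sizes of the components is `n`. -/
def sphMax (k n : ℕ) : Set (X k) := {s | IsGreatest {m | ∃ t ∈ s, RedPair.size t = m} n}

theorem finite_size_le (n : ℕ) : {t : RedPair | t.size ≤ n}.Finite := by
  classical
  let P : Finset BTree := (Finset.range (n + 1)).biUnion BinaryTree.treesOfNumNodesEq
  have hP : ∀ T : BTree, T.numNodes ≤ n → T ∈ P := by
    intro T hT
    exact Finset.mem_biUnion.2
      ⟨T.numNodes, Finset.mem_range.2 (by omega), BinaryTree.mem_treesOfNumNodesEq_numNodes T⟩
  refine Set.Finite.of_finite_image (f := fun t : RedPair => (t.dom, t.ran))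
    ((P ×ˢ P).finite_toSet.subset ?_) ?_
  · rintro _ ⟨t, ht, rfl⟩
    refine Finset.mem_coe.2 (Finset.mem_product.2 ⟨hP _ ht, hP _ ?_⟩)
    change t.dom.numNodes ≤ n at ht
    rwa [← t.numNodes_eq]
  · rintro ⟨a, b, _, _, _⟩ _ ⟨c, d, _, _, _⟩ _ h
    cases h
    rfl

/-- The spheres are finite, so that counting with `Set.ncard` is meaningful. -/
theorem finite_sphMax (k n : ℕ) : (sphMax k n).Finite := by
  classical
  refine Set.Finite.of_finite_image (f := fun s : X k => (s : Multiset RedPair))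
    (((k • (finite_size_le n).toFinset.val).powerset.toFinset.finite_toSet).subset ?_)
    (fun a _ b _ h => Sym.coe_injective h)
  rintro _ ⟨s, hs, rfl⟩
  simp only [Finset.mem_coe, Multiset.mem_toFinset, Multiset.mem_powerset]
  rw [Multiset.le_iff_count]
  intro t
  by_cases ht : t ∈ (s : Multiset RedPair)
  · have hmem : t ∈ (finite_size_le n).toFinset.val := by
      rw [Finset.mem_val, Set.Finite.mem_toFinset]
      exact hs.2 ⟨t, ht, rfl⟩
    have h1 : 1 ≤ Multiset.count t (finite_size_le n).toFinset.val :=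
      Multiset.one_le_count_iff_mem.2 hmem
    have h2 : Multiset.count t (s : Multiset RedPair) ≤ k :=
      (Multiset.count_le_card _ _).trans_eq s.2
    rw [Multiset.count_nsmul]
    nlinarith
  · rw [Multiset.count_eq_zero_of_notMem ht]
    exact Nat.zero_le _

/-- The set `A ⊆ X_k` has asymptotic density `d` with respect to the max stratification. -/
def HasDensity (k : ℕ) (A : Set (X k)) (d : ℝ) : Prop :=
  Tendsto (fun n : ℕ => ((A ∩ sphMax k n).ncard : ℝ) / ((sphMax k n).ncard : ℝ)) atTop (𝓝 d)

/-- The subgroup of `F` generated by a tuple of reduced tree pairs. -/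
def generated {k : ℕ} (s : X k) : Subgroup F := Subgroup.closure {f | ∃ t ∈ s, RedPair.toF t = f}

/-- The set of `k`-tuples that generate a subgroup of `F` isomorphic to `H`. -/
def tuplesGenerating (k : ℕ) (H : Type) [Group H] : Set (X k) :=
  {s | Nonempty (generated s ≃* H)}

/-- `H` is visible among the `k`-generated subgroups of `F`: the set of `k`-tuples generating
a copy of `H` has a density, and it is positive. -/
def IsVisible (k : ℕ) (H : Type) [Group H] : Prop :=
  ∃ d : ℝ, 0 < d ∧ HasDensity k (tuplesGenerating k H) d

/-- Isomorphism classes of groups. -/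
abbrev IsoClass : Type 1 := Quotient (CategoryTheory.isIsomorphicSetoid GrpCat.{0})

/-- The isomorphism class of a group. -/
def isoClass (H : Type) [Group H] : IsoClass := Quotient.mk _ (GrpCat.of H)

/-- The `k`-subgroup spectrum of `F` for the max stratification: the set of isomorphism classes
of visible subgroups of `F`. -/
def specMax (k : ℕ) : Set IsoClass :=
  {c | ∃ H : Subgroup F, isoClass H = c ∧ IsVisible k H}

end ThompsonF

end

open Filter Topology

noncomputable section

namespace ThompsonF

/-! ### Uniqueness of reduced tree pairs -/

/-! A tuple generating a copy of `ℤ` lies in one cyclic group, and an element of `F` has few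
partners in cyclic groups. Let `f ≠ 1` in `F` and let `a` be the end of the initial segment fixed by
`f`; to the right of `a` the slope of `f` is `2 ^ α` with `α ≠ 0`. If `f` and `h` are powers of the
same `g`, then `g` fixes `a`, and `h` has a slope `2 ^ β` there with `h ^ α = f ^ β`
(`exists_isGerm_of_mem_zpowers`). Roots in `F` are unique, because `F` is bi-orderable
(`isMulTorsionFree_F`), so `β` determines `h`. A slope is a quotient of leaf lengths, whence `|β|`
is at most the size of a tree pair of `h` (`RedPair.abs_le_size_of_isGerm`). So at most `2 * n + 1`
elements with tree pairs of size at most `n` are partners of `f` (`ncard_cyclicPartners_le`).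

Let `r` be the number of reduced pairs of size `n`. At most `r * (2 * n + 1) ^ (k - 1)` tuples of
the sphere generate a copy of `ℤ`, while the sphere has at least `r ^ k / k!` elements. As `r` grows
exponentially, the density is `0` for `k ≥ 2`. For `k = 1` and `n ≥ 2` the whole sphere generates
copies of `ℤ`, since a reduced pair of size at least `2` is a nontrivial element of a torsion-free
group.

Counting elements of `F` instead of tree pairs is legitimate because `RedPair.toF` is injective: the
domain tree of a reduced pair is the coarsest dyadic subdivision adapted to the map, and it then
determines the range tree. -/

theorem exposed_nonempty {T : BTree} (h : T ≠ .nil) : (exposed T).Nonempty := by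
  induction T with
  | nil => exact absurd rfl h
  | node a l r hl hr =>
    by_cases h1 : l = .nil
    · by_cases h2 : r = .nil
      · exact ⟨0, Or.inl (Or.inl ⟨h1, h2, rfl⟩)⟩
      · obtain ⟨j, hj⟩ := hr h2
        exact ⟨_, Or.inr ⟨j, hj, rfl⟩⟩
    · obtain ⟨j, hj⟩ := hl h1
      exact ⟨j, Or.inl (Or.inr hj)⟩

theorem leafMap_node_of_le {a : Unit} {l r : BTree} {x : ℝ} (h : x ≤ l.numLeaves) :
    leafMap (.node a l r) x = leafMap l x / 2 := by
  simp [leafMap, h]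

theorem leafMap_node_add {a : Unit} {l r : BTree} {x : ℝ} (h : 0 ≤ x) :
    leafMap (.node a l r) (l.numLeaves + x) = 1 / 2 + leafMap r x / 2 := by
  rcases h.eq_or_lt with rfl | h
  · simp [leafMap, leafMap_numLeaves, leafMap_zero]
  · have : ¬ ((l.numLeaves : ℝ) + x ≤ l.numLeaves) := by linarith
    simp [leafMap, this]

theorem leafMap_nonneg {T : BTree} {x : ℝ} (h : 0 ≤ x) : 0 ≤ leafMap T x :=
  (leafMap_zero T).ge.trans ((leafMap_strictMono T).monotone h)

theorem leafMap_le_one {T : BTree} {x : ℝ} (h : x ≤ T.numLeaves) : leafMap T x ≤ 1 :=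
  ((leafMap_strictMono T).monotone h).trans (leafMap_numLeaves T).le

theorem leafInv_zero (T : BTree) : leafInv T 0 = 0 := by
  rw [← leafMap_zero T, leafInv_leafMap, leafMap_zero]

theorem leafInv_one (T : BTree) : leafInv T 1 = T.numLeaves := by
  rw [← leafMap_numLeaves T, leafInv_leafMap]

theorem leafInv_nonneg {T : BTree} {x : ℝ} (h : 0 ≤ x) : 0 ≤ leafInv T x :=
  (leafInv_zero T).ge.trans ((leafInv_strictMono T).monotone h)

theorem eq_nil_of_numLeaves {T : BTree} (h : T.numLeaves = 1) : T = .nil := by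
  cases T with
  | nil => rfl
  | node a l r =>
    have := l.numLeaves_pos
    have := r.numLeaves_pos
    simp at h
    omega

/-- A tree is determined by the subdivision it describes. -/
theorem eq_of_leafMap_eq (S T : BTree) (hN : S.numLeaves = T.numLeaves)
    (h : ∀ x : ℝ, 0 ≤ x → x ≤ S.numLeaves → leafMap S x = leafMap T x) : S = T := by
  induction S generalizing T with
  | nil => exact (eq_nil_of_numLeaves hN.symm).symm
  | node a l r hl hr =>
    cases T with
    | nil => exact eq_nil_of_numLeaves hN
    | node b l' r' =>
      have hrp : (0 : ℝ) ≤ r.numLeaves := Nat.cast_nonneg _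
      -- The value `1 / 2` is attained exactly at the number of leaves of the left subtree.
      have hNl : l.numLeaves = l'.numLeaves := by
        have h1 := h l.numLeaves (Nat.cast_nonneg _) (by simp)
        rw [leafMap_node_of_le le_rfl, leafMap_numLeaves, ← leafMap_numLeaves l',
          ← leafMap_node_of_le (a := b) (r := r') le_rfl] at h1
        exact_mod_cast ((leafMap_strictMono _).injective h1).symm
      have hNr : r.numLeaves = r'.numLeaves := by
        simp only [BinaryTree.numLeaves] at hN
        omega
      have h1 : l = l' := by
        refine hl l' hNl fun x hx hx' => ?_
        have := h x hx (by push_cast [BinaryTree.numLeaves]; linarith)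
        rw [leafMap_node_of_le hx', leafMap_node_of_le (hNl ▸ hx')] at this
        linarith
      have h2 : r = r' := by
        refine hr r' hNr fun x hx hx' => ?_
        have := h (l.numLeaves + x) (by positivity) (by push_cast [BinaryTree.numLeaves]; linarith)
        rw [leafMap_node_add hx, hNl, leafMap_node_add hx] at this
        linarith
      rw [h1, h2]

/-- `f` maps `[0,1]` affinely onto a standard dyadic interval. -/
def MapsToDyadic (f : ℝ → ℝ) : Prop :=
  ∃ m d : ℕ, ∀ x : ℝ, 0 ≤ x → x ≤ 1 → f x = (m + x) / 2 ^ d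

theorem mapsToDyadic_leafMap (T : BTree) (i : ℕ) (hi : i < T.numLeaves) :
    MapsToDyadic fun x => leafMap T (i + x) := by
  induction T generalizing i with
  | nil =>
    refine ⟨i, 0, fun x _ _ => ?_⟩
    simp [leafMap]
  | node a l r hl hr =>
    by_cases h : i < l.numLeaves
    · obtain ⟨m, d, hm⟩ := hl i h
      refine ⟨m, d + 1, fun x hx hx' => ?_⟩
      have h1 : ((i : ℝ) + 1) ≤ l.numLeaves := by exact_mod_cast h
      have h2 := hm x hx hx'
      simp only at h2 ⊢
      rw [leafMap_node_of_le (by linarith), h2, pow_succ]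
      field_simp
    · obtain ⟨j, rfl⟩ := Nat.exists_eq_add_of_le (not_lt.1 h)
      obtain ⟨m, d, hm⟩ := hr j (by simpa using hi)
      refine ⟨2 ^ d + m, d + 1, fun x hx hx' => ?_⟩
      have h2 := hm x hx hx'
      simp only at h2 ⊢
      push_cast
      rw [add_assoc, leafMap_node_add (by positivity), h2, pow_succ]
      field_simp
      ring

/-- If the leaves of `T` from `i` on subdivide a standard dyadic interval in the way in which `S`
subdivides `[0,1]`, then `S` is a subtree of `T`; so they share an exposed caret. -/
theorem exists_common_exposed {S : BTree} (hS : S ≠ .nil) (T : BTree) (i m d : ℕ)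
    (hi : i + S.numLeaves ≤ T.numLeaves)
    (h : ∀ y : ℝ, 0 ≤ y → y ≤ S.numLeaves → leafMap T (i + y) = (m + leafMap S y) / 2 ^ d) :
    ∃ j ∈ exposed S, i + j ∈ exposed T := by
  have hSp : (0 : ℝ) ≤ S.numLeaves := Nat.cast_nonneg _
  have h0 := h 0 le_rfl hSp
  have h1 := h S.numLeaves hSp le_rfl
  rw [leafMap_zero, add_zero, add_zero] at h0
  rw [leafMap_numLeaves] at h1
  have hi' : (i : ℝ) + S.numLeaves ≤ T.numLeaves := by exact_mod_cast hi
  induction T generalizing i m d with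
  | nil =>
    have h2 := S.numLeaves_pos
    have : S.numLeaves = 1 := by
      simp only [BinaryTree.numLeaves] at hi
      omega
    exact absurd (eq_nil_of_numLeaves this) hS
  | node a l r hl hr =>
    -- For `d = 0` the interval is all of `[0,1]`, so `S` is the whole tree. Otherwise it lies in
    -- one half, the left one exactly when `m < 2 ^ d` for the decreased `d`, and the search
    -- descends into that subtree.
    rcases d with _ | d
    · have h2 := leafMap_le_one hi'
      have hm : m = 0 := by
        rw [h1, pow_zero, div_one] at h2
        have : (m : ℝ) ≤ 0 := by linarith
        exact_mod_cast this.antisymm (Nat.cast_nonneg m)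
      subst hm
      have hi0 : i = 0 := by
        rw [Nat.cast_zero, zero_div, ← leafMap_zero (.node a l r)] at h0
        exact_mod_cast (leafMap_strictMono _).injective h0
      subst hi0
      have hN : S.numLeaves = (BinaryTree.node a l r).numLeaves := by
        rw [Nat.cast_zero, pow_zero, zero_add, zero_add, div_one,
          ← leafMap_numLeaves (.node a l r)] at h1
        exact_mod_cast (leafMap_strictMono _).injective h1
      have : S = .node a l r := by
        refine eq_of_leafMap_eq _ _ hN fun x hx hx' => ?_
        have := h x hx hx'
        simpa using this.symm
      obtain ⟨j, hj⟩ := exposed_nonempty hS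
      exact ⟨j, hj, by simpa [← this] using hj⟩
    · have hp : (0 : ℝ) < 2 ^ d := by positivity
      have key : leafMap (.node a l r) l.numLeaves = 1 / 2 := by
        rw [leafMap_node_of_le le_rfl, leafMap_numLeaves]
      rcases Nat.lt_or_ge m (2 ^ d) with hm | hm
      · have hm' : (m : ℝ) + 1 ≤ 2 ^ d := by exact_mod_cast hm
        have hil : (i : ℝ) + S.numLeaves ≤ l.numLeaves := by
          rw [← (leafMap_strictMono (.node a l r)).le_iff_le, key, h1, pow_succ,
            div_le_div_iff₀ (by positivity) (by norm_num)]
          linarith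
        have hy : ∀ y : ℝ, 0 ≤ y → y ≤ S.numLeaves →
            leafMap l (i + y) = (m + leafMap S y) / 2 ^ d := by
          intro y hy hy'
          have := h y hy hy'
          rw [leafMap_node_of_le (by linarith), pow_succ] at this
          field_simp at this ⊢
          linarith
        obtain ⟨j, hj, hj'⟩ := hl i m d (by exact_mod_cast hil) hy
          (by simpa [leafMap_zero] using hy 0 le_rfl hSp)
          (by simpa [leafMap_numLeaves] using hy _ hSp le_rfl) hil
        exact ⟨j, hj, Or.inl (Or.inr hj')⟩
      · obtain ⟨m, rfl⟩ := Nat.exists_eq_add_of_le hm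
        have hil : (l.numLeaves : ℝ) ≤ i := by
          rw [← (leafMap_strictMono (.node a l r)).le_iff_le, key, h0, pow_succ,
            div_le_div_iff₀ (by norm_num) (by positivity)]
          push_cast
          have : (0 : ℝ) ≤ m := Nat.cast_nonneg _
          linarith
        obtain ⟨i, rfl⟩ := Nat.exists_eq_add_of_le (by exact_mod_cast hil : l.numLeaves ≤ i)
        have hy : ∀ y : ℝ, 0 ≤ y → y ≤ S.numLeaves →
            leafMap r (i + y) = (m + leafMap S y) / 2 ^ d := by
          intro y hy hy'
          have := h y hy hy'
          push_cast at this
          rw [add_assoc, leafMap_node_add (by positivity), pow_succ] at this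
          field_simp at this ⊢
          linarith
        have hir : i + S.numLeaves ≤ r.numLeaves := by
          simp only [BinaryTree.numLeaves] at hi
          omega
        obtain ⟨j, hj, hj'⟩ := hr i m d hir hy
          (by simpa [leafMap_zero] using hy 0 le_rfl hSp)
          (by simpa [leafMap_numLeaves] using hy _ hSp le_rfl) (by exact_mod_cast hir)
        exact ⟨j, hj, Or.inr ⟨i + j, hj', by ring⟩⟩

/-- `S` describes the coarsest standard dyadic subdivision of `[0,1]` such that `f` maps each of its
intervals affinely onto a standard dyadic interval. -/
def IsCoarsest : BTree → (ℝ → ℝ) → Prop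
  | .nil, f => MapsToDyadic f
  | .node _ l r, f => ¬ MapsToDyadic f ∧ IsCoarsest l (fun x => f (x / 2)) ∧
      IsCoarsest r (fun x => f ((1 + x) / 2))

theorem MapsToDyadic.congr {f g : ℝ → ℝ} (h : ∀ x, 0 ≤ x → x ≤ 1 → f x = g x)
    (hf : MapsToDyadic f) : MapsToDyadic g := by
  obtain ⟨m, d, hm⟩ := hf
  exact ⟨m, d, fun x hx hx' => by rw [← h x hx hx', hm x hx hx']⟩

theorem IsCoarsest.congr {S : BTree} {f g : ℝ → ℝ} (h : ∀ x, 0 ≤ x → x ≤ 1 → f x = g x)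
    (hf : IsCoarsest S f) : IsCoarsest S g := by
  induction S generalizing f g with
  | nil => exact MapsToDyadic.congr h hf
  | node a l r hl hr =>
    obtain ⟨h1, h2, h3⟩ := hf
    refine ⟨fun hg => h1 (hg.congr fun x hx hx' => (h x hx hx').symm),
      hl (fun x hx hx' => h _ ?_ ?_) h2, hr (fun x hx hx' => h _ ?_ ?_) h3⟩ <;> linarith

/-- Whether a vertex is a leaf or a caret is dictated by `f` alone. -/
theorem IsCoarsest.eq {S T : BTree} {f : ℝ → ℝ} (hS : IsCoarsest S f) (hT : IsCoarsest T f) :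
    S = T := by
  induction S generalizing T f with
  | nil =>
    cases T with
    | nil => rfl
    | node b l' r' => exact absurd hS hT.1
  | node a l r hl hr =>
    cases T with
    | nil => exact absurd hT hS.1
    | node b l' r' => rw [hl hS.2.1 hT.2.1, hr hS.2.2 hT.2.2]

theorem leafInv_node_half {a : Unit} {l r : BTree} {x : ℝ} (h : x ≤ 1) :
    leafInv (.node a l r) (x / 2) = leafInv l x := by
  have : x / 2 ≤ 1 / 2 := by linarith
  simp only [leafInv, this, if_true]
  congr 1
  ring

theorem leafInv_node_half_add {a : Unit} {l r : BTree} {x : ℝ} (h : 0 ≤ x) :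
    leafInv (.node a l r) ((1 + x) / 2) = l.numLeaves + leafInv r x := by
  have hs := leafMap_strictMono (.node a l r)
  apply hs.injective
  rw [leafMap_leafInv, leafMap_node_add (leafInv_nonneg h), leafMap_leafInv]
  ring

/-- If the map were already dyadic affine on the interval of a caret of `S`, the subtree below that
caret would reappear in `T`, giving a common exposed caret. The offset `i` lets the induction pass
to subtrees of the domain tree while keeping `T` fixed. -/
theorem isCoarsest_leafMap (S T : BTree) (i : ℕ) (hi : i + S.numLeaves ≤ T.numLeaves)
    (h : ∀ j ∈ exposed S, i + j ∉ exposed T) :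
    IsCoarsest S fun x => leafMap T (i + leafInv S x) := by
  induction S generalizing i with
  | nil => exact mapsToDyadic_leafMap T i (by simpa using hi)
  | node a l r hl hr =>
    have hi' := hi
    simp only [BinaryTree.numLeaves] at hi'
    refine ⟨?_, ?_, ?_⟩
    · rintro ⟨m, d, hm⟩
      obtain ⟨j, hj, hj'⟩ := exists_common_exposed (S := .node a l r) (by simp) T i m d hi
        fun y hy hy' => by
          have := hm (leafMap (.node a l r) y) (leafMap_nonneg hy) (leafMap_le_one hy')
          simpa only [leafInv_leafMap _ y] using this
      exact h j hj hj'
    · refine (hl i (by omega) fun j hj => h j (Or.inl (Or.inr hj))).congr fun x hx hx' => ?_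
      simp only [leafInv_node_half hx']
    · refine (hr (i + l.numLeaves) (by omega) fun j hj => ?_).congr fun x hx hx' => ?_
      · rw [add_assoc, add_comm l.numLeaves]
        exact h _ (Or.inr ⟨j, hj, rfl⟩)
      · simp only [leafInv_node_half_add hx]
        push_cast
        rw [add_assoc]

theorem RedPair.ext' {s t : RedPair} (h1 : s.dom = t.dom) (h2 : s.ran = t.ran) : s = t := by
  cases s
  cases t
  simp_all

theorem RedPair.isCoarsest (t : RedPair) (h : 2 ≤ t.size) :
    IsCoarsest t.dom fun x => leafMap t.ran (leafInv t.dom x) := by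
  have := isCoarsest_leafMap t.dom t.ran 0 (by rw [zero_add, t.numLeaves_eq]) fun j hj => by
    rw [zero_add]
    exact Set.disjoint_left.1 (t.reduced h) hj
  simpa using this

theorem numNodes_eq_one_iff {T : BTree} : T.numNodes = 1 ↔ T = .node () .nil .nil := by
  constructor
  · intro h
    cases T with
    | nil => simp at h
    | node a l r =>
      simp only [BinaryTree.numNodes] at h
      rw [eq_nil_of_numLeaves (T := l) (by rw [BinaryTree.numLeaves_eq_numNodes_succ]; omega),
        eq_nil_of_numLeaves (T := r) (by rw [BinaryTree.numLeaves_eq_numNodes_succ]; omega)]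
  · rintro rfl
    rfl

theorem RedPair.size_pos (t : RedPair) : 1 ≤ t.size := t.numNodes_pos

theorem RedPair.dom_of_size_eq_one {t : RedPair} (h : t.size = 1) :
    t.dom = .node () .nil .nil := numNodes_eq_one_iff.1 h

theorem RedPair.ran_of_size_eq_one {t : RedPair} (h : t.size = 1) :
    t.ran = .node () .nil .nil := numNodes_eq_one_iff.1 (t.numNodes_eq ▸ h)

theorem RedPair.eq_of_size_eq_one {s t : RedPair} (hs : s.size = 1) (ht : t.size = 1) : s = t :=
  RedPair.ext' (by rw [dom_of_size_eq_one hs, dom_of_size_eq_one ht])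
    (by rw [ran_of_size_eq_one hs, ran_of_size_eq_one ht])

theorem RedPair.coe_toF_apply (t : RedPair) (x : I) :
    (((t.toF : I ≃o I) x : I) : ℝ) = leafMap t.ran (leafInv t.dom x) := rfl

theorem RedPair.toF_eq_one_of_size {t : RedPair} (h : t.size = 1) : t.toF = 1 := by
  ext x
  rw [coe_toF_apply, dom_of_size_eq_one h, ran_of_size_eq_one h, leafMap_leafInv]
  rfl

/-- The coarsest subdivision adapted to the identity is the single leaf, whereas `t.dom` has a
caret. -/
theorem RedPair.toF_ne_one {t : RedPair} (h : 2 ≤ t.size) : t.toF ≠ 1 := by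
  intro h1
  have h2 := t.isCoarsest h
  have h3 : MapsToDyadic fun x => leafMap t.ran (leafInv t.dom x) := by
    refine ⟨0, 0, fun x hx hx' => ?_⟩
    have := t.coe_toF_apply ⟨x, hx, hx'⟩
    rw [h1] at this
    simpa using this.symm
  have h4 : IsCoarsest .nil fun x => leafMap t.ran (leafInv t.dom x) := h3
  have h5 := h2.eq h4
  have h6 := t.numNodes_pos
  rw [h5] at h6
  simp at h6

/-- An element of `F` is represented by only one reduced tree pair. -/
theorem RedPair.toF_injective : Function.Injective RedPair.toF := by
  intro s t h
  by_cases hs : s.size = 1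
  · by_cases ht : t.size = 1
    · exact eq_of_size_eq_one hs ht
    · exact absurd (h ▸ toF_eq_one_of_size hs) (toF_ne_one (by have := t.size_pos; omega))
  · have hs' : 2 ≤ s.size := by have := s.size_pos; omega
    have ht' : 2 ≤ t.size := by
      have := t.size_pos
      by_contra h2
      exact toF_ne_one hs' (h ▸ toF_eq_one_of_size (by omega))
    have key : ∀ x : ℝ, 0 ≤ x → x ≤ 1 →
        leafMap s.ran (leafInv s.dom x) = leafMap t.ran (leafInv t.dom x) := fun x hx hx' => by
      rw [← s.coe_toF_apply ⟨x, hx, hx'⟩, h, t.coe_toF_apply]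
    have hd : s.dom = t.dom := ((s.isCoarsest hs').congr key).eq (t.isCoarsest ht')
    refine RedPair.ext' hd (eq_of_leafMap_eq _ _ ?_ fun x hx hx' => ?_)
    · rw [← s.numLeaves_eq, ← t.numLeaves_eq, hd]
    · have := key (leafMap s.dom x) (leafMap_nonneg hx)
        (leafMap_le_one (by rwa [s.numLeaves_eq]))
      rwa [← hd, leafInv_leafMap] at this

/-! ### A bi-invariant order on `F` -/

/-- `f` is the identity on `[0,a]` and lies above the identity immediately to the right of `a`. -/
def IsPos (f : I ≃o I) : Prop :=
  ∃ a b : I, a < b ∧ (∀ x ≤ a, f x = x) ∧ ∀ x, a < x → x < b → x < f x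

theorem not_isPos_one : ¬ IsPos 1 := by
  rintro ⟨a, b, hab, -, h⟩
  obtain ⟨x, hx, hx'⟩ := exists_between hab
  exact lt_irrefl x (h x hx hx')

/-- The factor that starts to move points first decides; if both start at the same point, both push
to the right. -/
theorem IsPos.mul {f g : I ≃o I} (hf : IsPos f) (hg : IsPos g) : IsPos (f * g) := by
  obtain ⟨a, b, hab, hf1, hf2⟩ := hf
  obtain ⟨a', b', hab', hg1, hg2⟩ := hg
  rcases lt_trichotomy a a' with h | rfl | h
  · refine ⟨a, min b a', lt_min hab h, fun x hx => ?_, fun x hx hx' => ?_⟩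
    · rw [RelIso.mul_apply, hg1 x (hx.trans h.le), hf1 x hx]
    · rw [RelIso.mul_apply, hg1 x (hx'.le.trans (min_le_right _ _))]
      exact hf2 x hx (hx'.trans_le (min_le_left _ _))
  · refine ⟨a, min b b', lt_min hab hab', fun x hx => ?_, fun x hx hx' => ?_⟩
    · rw [RelIso.mul_apply, hg1 x hx, hf1 x hx]
    · rw [RelIso.mul_apply]
      exact (hf2 x hx (hx'.trans_le (min_le_left _ _))).trans
        (f.strictMono (hg2 x hx (hx'.trans_le (min_le_right _ _))))
  · refine ⟨a', min b' a, lt_min hab' h, fun x hx => ?_, fun x hx hx' => ?_⟩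
    · rw [RelIso.mul_apply, hg1 x hx, hf1 x (hx.trans h.le)]
    · rw [RelIso.mul_apply]
      exact (hf1 x (hx'.le.trans (min_le_right _ _))).ge.trans_lt
        (f.strictMono (hg2 x hx (hx'.trans_le (min_le_left _ _))))

theorem IsPos.conj {f : I ≃o I} (hf : IsPos f) (h : I ≃o I) : IsPos (h * f * h⁻¹) := by
  obtain ⟨a, b, hab, hf1, hf2⟩ := hf
  refine ⟨h a, h b, h.strictMono hab, fun x hx => ?_, fun x hx hx' => ?_⟩
  · obtain ⟨y, rfl⟩ := h.surjective x
    rw [RelIso.mul_apply, RelIso.mul_apply, RelIso.inv_apply_self, hf1 y (h.le_iff_le.1 hx)]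
  · obtain ⟨y, rfl⟩ := h.surjective x
    rw [RelIso.mul_apply, RelIso.mul_apply, RelIso.inv_apply_self]
    exact h.strictMono (hf2 y (h.lt_iff_lt.1 hx) (h.lt_iff_lt.1 hx'))

/-- The inductive step writes `(u ^ (n + 1))⁻¹ * v ^ (n + 1)` as the conjugate of `u⁻¹ * v` by `(u ^
n)⁻¹`, times `(u ^ n)⁻¹ * v ^ n`. -/
theorem IsPos.inv_pow_mul_pow {u v : I ≃o I} (h : IsPos (u⁻¹ * v)) {n : ℕ} (hn : n ≠ 0) :
    IsPos ((u ^ n)⁻¹ * v ^ n) := by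
  induction n with
  | zero => exact absurd rfl hn
  | succ n ih =>
    rcases eq_or_ne n 0 with rfl | hn'
    · simpa using h
    · have h1 := (h.conj (u ^ n)⁻¹).mul (ih hn')
      rw [pow_succ' u, pow_succ' v]
      convert h1 using 1
      group

/-! ### Germs to the right of a point -/

/-- `f` is affine with slope `2 ^ k` immediately to the right of `a`. -/
def IsGerm (f : I ≃o I) (a : I) (k : ℤ) : Prop :=
  ∃ b, a < b ∧ ∀ x, a ≤ x → x ≤ b → (f x : ℝ) - f a = (2 : ℝ) ^ k * ((x : ℝ) - a)

theorem exists_isGerm {f : I ≃o I} (hf : IsDyadicPL f) {a : I} (ha : a < ⊤) :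
    ∃ k, IsGerm f a k := by
  classical
  obtain ⟨B, -, hB⟩ := hf
  -- Take the first breakpoint after `a`; inserting `⊤` ensures that one exists.
  obtain ⟨b, hb, hmin⟩ := ((insert ⊤ B).filter (fun b => a < b)).exists_min_image id
    ⟨⊤, by simpa using ha⟩
  simp only [Finset.mem_filter, Finset.mem_insert, id] at hb hmin
  obtain ⟨k, hk⟩ := hB a b hb.2.le fun c hc h => (hmin c ⟨Or.inr hc, h.1⟩).not_gt h.2
  exact ⟨k, b, hb.2, hk⟩

theorem IsGerm.lt_top {f : I ≃o I} {a : I} {k : ℤ} (h : IsGerm f a k) : a < ⊤ := by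
  obtain ⟨b, hb, -⟩ := h
  exact hb.trans_le le_top

theorem IsGerm.unique {f : I ≃o I} {a : I} {k l : ℤ} (hk : IsGerm f a k) (hl : IsGerm f a l) :
    k = l := by
  obtain ⟨b, hb, h⟩ := hk
  obtain ⟨c, hc, h'⟩ := hl
  have h1 := h (min b c) (le_min hb.le hc.le) (min_le_left _ _)
  rw [h' (min b c) (le_min hb.le hc.le) (min_le_right _ _)] at h1
  have h2 : (a : ℝ) < (min b c : I) := lt_min hb hc
  have h3 := mul_right_cancel₀ (sub_pos.2 h2).ne' h1
  exact (zpow_right_injective₀ (by norm_num) (by norm_num) h3).symm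

theorem IsGerm.mul {f g : I ≃o I} {a : I} {k l : ℤ} (hf : IsGerm f a k) (hg : IsGerm g a l)
    (ha : g a = a) : IsGerm (f * g) a (k + l) := by
  obtain ⟨b, hb, h⟩ := hf
  obtain ⟨c, hc, h'⟩ := hg
  refine ⟨min (g.symm b) c, lt_min (g.lt_symm_apply.2 (ha.trans_lt hb)) hc, fun x hx hx' => ?_⟩
  have h1 : a ≤ g x := ha.ge.trans (g.monotone hx)
  have h2 : g x ≤ b := g.le_symm_apply.1 (hx'.trans (min_le_left _ _))
  have h3 := h' x hx (hx'.trans (min_le_right _ _))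
  rw [ha] at h3
  rw [RelIso.mul_apply, RelIso.mul_apply, ha, h _ h1 h2, h3, zpow_add₀ (by norm_num), mul_assoc]

theorem IsGerm.inv {f : I ≃o I} {a : I} {k : ℤ} (hf : IsGerm f a k) (ha : f a = a) :
    IsGerm f⁻¹ a (-k) := by
  obtain ⟨b, hb, h⟩ := hf
  have ha' : f⁻¹ a = a := by
    conv_lhs => rw [← ha]
    exact RelIso.inv_apply_self f a
  refine ⟨f b, ha.ge.trans_lt (f.strictMono hb), fun x hx hx' => ?_⟩
  obtain ⟨y, rfl⟩ := f.surjective x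
  have h1 := h y (f.le_iff_le.1 (ha.le.trans hx)) (f.le_iff_le.1 hx')
  rw [ha] at h1
  rw [RelIso.inv_apply_self, ha', h1, ← mul_assoc, ← zpow_add₀ (by norm_num)]
  simp

theorem isGerm_one {a : I} (ha : a < ⊤) : IsGerm 1 a 0 := ⟨⊤, ha, fun x _ _ => by simp⟩

theorem IsGerm.zpow {f : I ≃o I} {a : I} {k : ℤ} (hf : IsGerm f a k) (ha : f a = a) (n : ℤ) :
    IsGerm (f ^ n) a (n * k) := by
  have ha' : f⁻¹ a = a := by
    conv_lhs => rw [← ha]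
    exact RelIso.inv_apply_self f a
  induction n with
  | zero => simpa using isGerm_one hf.lt_top
  | succ n ih =>
    rw [zpow_add_one, add_one_mul]
    exact ih.mul hf ha
  | pred n ih =>
    rw [zpow_sub_one, sub_one_mul, sub_eq_add_neg]
    exact ih.mul (hf.inv ha) ha'

theorem lt_pow_apply {f : I ≃o I} {a : I} (h : a < f a) {n : ℕ} (hn : n ≠ 0) : a < (f ^ n) a := by
  induction n with
  | zero => exact absurd rfl hn
  | succ n ih =>
    rw [pow_succ, RelIso.mul_apply]
    rcases eq_or_ne n 0 with rfl | hn'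
    · simpa using h
    · exact (ih hn').trans ((f ^ n).strictMono h)

theorem pow_apply_lt {f : I ≃o I} {a : I} (h : f a < a) {n : ℕ} (hn : n ≠ 0) : (f ^ n) a < a := by
  induction n with
  | zero => exact absurd rfl hn
  | succ n ih =>
    rw [pow_succ, RelIso.mul_apply]
    rcases eq_or_ne n 0 with rfl | hn'
    · simpa using h
    · exact ((f ^ n).strictMono h).trans (ih hn')

/-- Under iteration of an increasing map a moved point keeps moving in the same direction and never
returns. -/
theorem apply_eq_of_pow {f : I ≃o I} {a : I} {n : ℕ} (hn : n ≠ 0) (h : (f ^ n) a = a) :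
    f a = a := by
  rcases lt_trichotomy (f a) a with h1 | h1 | h1
  · exact absurd h (pow_apply_lt h1 hn).ne
  · exact h1
  · exact absurd h (lt_pow_apply h1 hn).ne'

theorem apply_eq_of_zpow {f : I ≃o I} {a : I} {n : ℤ} (hn : n ≠ 0) (h : (f ^ n) a = a) :
    f a = a := by
  obtain ⟨m, rfl | rfl⟩ := n.eq_nat_or_neg
  · rw [zpow_natCast] at h
    exact apply_eq_of_pow (by simpa using hn) h
  · rw [zpow_neg, zpow_natCast] at h
    refine apply_eq_of_pow (by simpa using hn) (n := m) ?_
    conv_lhs => rw [← h]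
    exact RelIso.apply_inv_self _ _

/-- The point is the supremum of the initial segment fixed by `f`. With slope `1` to its right, `f`
would be the identity on a longer segment. -/
theorem exists_isGerm_ne_zero {f : I ≃o I} (hf : IsDyadicPL f) (h1 : f ≠ 1) :
    ∃ a k, (∀ x ≤ a, f x = x) ∧ k ≠ 0 ∧ IsGerm f a k := by
  let A : Set I := {x | ∀ y ≤ x, f y = y}
  have hA : ∀ x < sSup A, f x = x := fun x hx => by
    obtain ⟨y, hy, hxy⟩ := exists_lt_of_lt_csSup ⟨⊥, fun y hy => by
      rw [le_bot_iff.1 hy, OrderIso.map_bot]⟩ hx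
    exact hy x hxy.le
  -- No continuity is needed: if the supremum were moved, its image or its preimage would lie below
  -- it and hence be fixed, against injectivity.
  have hfa : f (sSup A) = sSup A := by
    rcases lt_trichotomy (f (sSup A)) (sSup A) with h | h | h
    · exact f.injective (hA _ h)
    · exact h
    · have h2 := hA _ (f.symm_apply_lt.2 h)
      rw [f.apply_symm_apply] at h2
      exact absurd h2.symm (f.symm_apply_lt.2 h).ne
  have hA' : ∀ x ≤ sSup A, f x = x := fun x hx => by
    rcases hx.eq_or_lt with rfl | hx
    · exact hfa
    · exact hA x hx
  have htop : sSup A < ⊤ := by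
    refine lt_top_iff_ne_top.2 fun h => h1 ?_
    ext x
    rw [hA' x (h ▸ le_top)]
    rfl
  obtain ⟨k, hk⟩ := exists_isGerm hf htop
  refine ⟨_, k, hA', ?_, hk⟩
  rintro rfl
  obtain ⟨b, hb, hk⟩ := hk
  refine hb.not_ge (le_sSup fun y hy => ?_)
  rcases le_total y (sSup A) with h | h
  · exact hA' y h
  · have := hk y h hy
    rw [hfa, zpow_zero, one_mul] at this
    exact Subtype.ext (by linarith)

theorem IsGerm.isPos {f : I ≃o I} {a : I} {k : ℤ} (hf : IsGerm f a k) (ha : ∀ x ≤ a, f x = x)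
    (hk : 0 < k) : IsPos f := by
  obtain ⟨b, hb, h⟩ := hf
  refine ⟨a, b, hb, ha, fun x hx hx' => ?_⟩
  have h1 := h x hx.le hx'.le
  rw [ha a le_rfl] at h1
  have h2 : (1 : ℝ) < 2 ^ k := one_lt_zpow₀ (by norm_num) hk
  have h3 : (0 : ℝ) < x - a := sub_pos.2 hx
  have : (x : ℝ) < f x := by nlinarith
  exact this

theorem isPos_or_isPos_inv {f : I ≃o I} (hf : IsDyadicPL f) (h1 : f ≠ 1) :
    IsPos f ∨ IsPos f⁻¹ := by
  obtain ⟨a, k, ha, hk, hg⟩ := exists_isGerm_ne_zero hf h1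
  rcases hk.lt_or_gt with hk | hk
  · refine Or.inr ((hg.inv (ha a le_rfl)).isPos (fun x hx => ?_) (neg_pos.2 hk))
    conv_lhs => rw [← ha x hx]
    exact RelIso.inv_apply_self f x
  · exact Or.inl (hg.isPos ha hk)

/-- If `u ≠ v`, one of `u⁻¹ * v` and `v⁻¹ * u` is positive. With equal `n`-th powers, positivity of
the quotient of the powers would make the identity positive. -/
instance isMulTorsionFree_F : IsMulTorsionFree F where
  pow_left_injective := by
    intro n hn u v huv
    have huv' : (u : I ≃o I) ^ n = (v : I ≃o I) ^ n := congrArg Subtype.val huv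
    by_contra hne
    have h1 : (u : I ≃o I)⁻¹ * v ≠ 1 := fun h => hne (Subtype.ext (inv_mul_eq_one.1 h))
    rcases isPos_or_isPos_inv (F.mul_mem (F.inv_mem u.2) v.2) h1 with h | h
    · have := h.inv_pow_mul_pow hn
      rw [huv', inv_mul_cancel] at this
      exact not_isPos_one this
    · rw [mul_inv_rev, inv_inv] at h
      have := h.inv_pow_mul_pow hn
      rw [huv', inv_mul_cancel] at this
      exact not_isPos_one this

/-! ### Slopes are bounded by the size -/

/-- The slope on a leaf is `2 ^ (-d)` with `d` its depth, and the depth is at most the number of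
carets. -/
theorem leafMap_right_affine (T : BTree) (x : ℝ) : ∃ d : ℕ, d ≤ T.numNodes ∧ ∃ ε : ℝ, 0 < ε ∧
    ∀ δ : ℝ, 0 ≤ δ → δ ≤ ε → leafMap T (x + δ) = leafMap T x + (2 : ℝ) ^ (-(d : ℤ)) * δ := by
  induction T generalizing x with
  | nil => exact ⟨0, le_rfl, 1, one_pos, fun δ _ _ => by simp [leafMap]⟩
  | node a l r hl hr =>
    have h2 : ∀ d : ℕ, (2 : ℝ) ^ (-((d + 1 : ℕ) : ℤ)) = (2 : ℝ) ^ (-(d : ℤ)) / 2 := by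
      intro d
      rw [zpow_neg, zpow_neg, zpow_natCast, zpow_natCast, pow_succ]
      field_simp
    by_cases hx : x < l.numLeaves
    · obtain ⟨d, hd, ε, hε, h⟩ := hl x
      refine ⟨d + 1, by simp; omega, min ε (l.numLeaves - x), lt_min hε (sub_pos.2 hx),
        fun δ h0 h1 => ?_⟩
      have h3 := h1.trans (min_le_right _ _)
      rw [leafMap_node_of_le (by linarith), leafMap_node_of_le hx.le,
        h δ h0 (h1.trans (min_le_left _ _)), h2]
      ring
    · obtain ⟨y, hy, rfl⟩ : ∃ y : ℝ, 0 ≤ y ∧ x = l.numLeaves + y :=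
        ⟨x - l.numLeaves, by linarith, by ring⟩
      obtain ⟨d, hd, ε, hε, h⟩ := hr y
      refine ⟨d + 1, by simp; omega, ε, hε, fun δ h0 h1 => ?_⟩
      rw [add_assoc, leafMap_node_add (by linarith), leafMap_node_add hy, h δ h0 h1, h2]
      ring

theorem RedPair.abs_le_size_of_isGerm {t : RedPair} {a : I} {k : ℤ} (h : IsGerm t.toF a k) :
    |k| ≤ t.size := by
  obtain ⟨b, hb, h⟩ := h
  obtain ⟨d, hd, ε, hε, h1⟩ := leafMap_right_affine t.dom (leafInv t.dom a)
  obtain ⟨e, he, ε', hε', h2⟩ := leafMap_right_affine t.ran (leafInv t.dom a)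
  have hba : (0 : ℝ) < b - a := sub_pos.2 hb
  -- The last bound keeps the step of length `2 ^ (-d) * δ` from `a` inside `[a, b]`, where the germ
  -- is valid.
  set δ := min (min ε ε') ((2 : ℝ) ^ (d : ℤ) * (b - a)) with hδ
  have hδ0 : 0 < δ := lt_min (lt_min hε hε') (by positivity)
  have h3 := h1 δ hδ0.le ((min_le_left _ _).trans (min_le_left _ _))
  have h4 := h2 δ hδ0.le ((min_le_left _ _).trans (min_le_right _ _))
  rw [leafMap_leafInv] at h3
  have h5 : (2 : ℝ) ^ (-(d : ℤ)) * δ ≤ b - a := by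
    have : δ ≤ (2 : ℝ) ^ (d : ℤ) * (b - a) := min_le_right _ _
    rw [zpow_neg, inv_mul_le_iff₀ (by positivity)]
    exact this
  have h6 : 0 < (2 : ℝ) ^ (-(d : ℤ)) * δ := by positivity
  have ha0 := a.2.1
  have hb1 := b.2.2
  have h7 := h ⟨a + (2 : ℝ) ^ (-(d : ℤ)) * δ, by linarith, by linarith⟩
    (Subtype.coe_le_coe.1 (by simp only; linarith)) (Subtype.coe_le_coe.1 (by simp only; linarith))
  rw [t.coe_toF_apply, t.coe_toF_apply] at h7
  simp only at h7
  rw [← h3, leafInv_leafMap, h4, h3, add_sub_cancel_left, add_sub_cancel_left, ← mul_assoc,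
    ← zpow_add₀ (by norm_num)] at h7
  have h8 := zpow_right_injective₀ (by norm_num) (by norm_num) (mul_right_cancel₀ hδ0.ne' h7)
  have h9 : t.ran.numNodes = t.dom.numNodes := t.numNodes_eq.symm
  simp only [RedPair.size]
  rw [abs_le]
  omega

/-! ### Cyclic subgroups containing a given element -/

/-- If `f = g ^ i`, `h = g ^ j` and `g` has slope `2 ^ γ` at `a`, then `α = i * γ` and `β = j * γ`,
so both powers equal `g ^ (i * j * γ)`. -/
theorem exists_isGerm_of_mem_zpowers {f g h : F} {a : I} {α : ℤ} (hα : IsGerm f a α)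
    (ha : (f : I ≃o I) a = a) (hf : f ≠ 1) (hfg : f ∈ Subgroup.zpowers g)
    (hhg : h ∈ Subgroup.zpowers g) : ∃ β, IsGerm h a β ∧ h ^ α = f ^ β := by
  obtain ⟨i, rfl⟩ := hfg
  obtain ⟨j, rfl⟩ := hhg
  simp only at *
  have hi : i ≠ 0 := by
    rintro rfl
    simp at hf
  have hga : (g : I ≃o I) a = a := apply_eq_of_zpow hi (by simpa using ha)
  obtain ⟨γ, hγ⟩ := exists_isGerm g.2 hα.lt_top
  have h1 : α = i * γ := hα.unique (by simpa using hγ.zpow hga i)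
  refine ⟨j * γ, by simpa using hγ.zpow hga j, ?_⟩
  rw [← zpow_mul, ← zpow_mul, h1]
  congr 1
  ring

/-- The reduced tree pairs of size at most `n` that lie in a common cyclic group with `f`. -/
def cyclicPartners (f : F) (n : ℕ) : Set RedPair :=
  {u | u.size ≤ n ∧ ∃ g : F, f ∈ Subgroup.zpowers g ∧ u.toF ∈ Subgroup.zpowers g}

/-- A partner `u` is determined by its slope exponent `β` at `a`, through `u ^ α = f ^ β` and
uniqueness of roots; and `β` ranges over `[-n, n]`. -/
theorem ncard_cyclicPartners_le {f : F} (hf : f ≠ 1) (n : ℕ) :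
    (cyclicPartners f n).ncard ≤ 2 * n + 1 := by
  obtain ⟨a, α, ha, hα0, hα⟩ := exists_isGerm_ne_zero f.2
    (fun h => hf (Subtype.ext h))
  have key : ∀ u ∈ cyclicPartners f n, ∃ β, IsGerm u.toF a β ∧ u.toF ^ α = f ^ β := by
    rintro u ⟨-, g, hfg, hug⟩
    exact exists_isGerm_of_mem_zpowers hα (ha a le_rfl) hf hfg hug
  choose! β hβ1 hβ2 using key
  have h1 : (cyclicPartners f n).ncard ≤ (Finset.Icc (-(n : ℤ)) n : Set ℤ).ncard := by
    refine Set.ncard_le_ncard_of_injOn β (fun u hu => ?_) (fun u hu v hv huv => ?_)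
      (Finset.finite_toSet _)
    · have := abs_le.1 ((RedPair.abs_le_size_of_isGerm (hβ1 u hu)).trans (Nat.cast_le.2 hu.1))
      simpa using this
    · refine RedPair.toF_injective (zpow_left_injective hα0 ?_)
      simp only
      rw [hβ2 u hu, hβ2 v hv, huv]
  rw [Set.ncard_coe_finset, Int.card_Icc] at h1
  omega

/-! ### The number of reduced tree pairs -/

/-- The reduced tree pairs of size `n`. -/
def redPairs (n : ℕ) : Finset RedPair :=
  ((finite_size_le n).subset fun t (ht : t.size = n) => ht.le).toFinset

theorem mem_redPairs {n : ℕ} {t : RedPair} : t ∈ redPairs n ↔ t.size = n :=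
  Set.Finite.mem_toFinset _

/-- The first and last terms of the Catalan recursion already double the previous value. -/
theorem two_pow_le_catalan (n : ℕ) : 2 ^ n ≤ catalan (n + 1) := by
  induction n with
  | zero => simp
  | succ n ih =>
    rw [catalan_succ, Fin.sum_univ_succ, Fin.sum_univ_castSucc]
    simp only [Fin.val_zero, catalan_zero, one_mul, Nat.sub_zero, Fin.val_succ, Fin.val_last,
      Nat.sub_self, mul_one]
    rw [pow_succ]
    omega

/-- The tree with `n` carets all of whose carets lie on the left side. -/
def leftComb : ℕ → BTree
  | 0 => .nil
  | n + 1 => .node () (leftComb n) .nil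

theorem numNodes_leftComb (n : ℕ) : (leftComb n).numNodes = n := by
  induction n with
  | zero => rfl
  | succ n ih => simp [leftComb, ih]

theorem exposed_leftComb_subset (n : ℕ) : exposed (leftComb n) ⊆ {0} := by
  induction n with
  | zero => simp [leftComb, exposed]
  | succ n ih =>
    rintro j ((⟨-, -, rfl⟩ | hj) | ⟨i, hi, -⟩)
    · rfl
    · exact ih hj
    · exact hi.elim

/-- Pair the left comb with a root whose left child is a leaf and whose right child is any tree with
`n + 1` carets. The comb exposes only a caret at leaf `0`; in the other tree, leaf `0` hangs from
the root, whose right child is not a leaf. -/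
theorem two_pow_le_card_redPairs (n : ℕ) : 2 ^ n ≤ (redPairs (n + 2)).card := by
  refine (two_pow_le_catalan n).trans ?_
  rw [← BinaryTree.treesOfNumNodesEq_card_eq_catalan, ← Finset.card_attach]
  refine Finset.card_le_card_of_injOn
    (fun T => ⟨leftComb (n + 2), .node () .nil T.1, ?_, ?_, fun _ => ?_⟩) (fun T _ => ?_)
    fun T _ T' _ h => ?_
  · have := BinaryTree.mem_treesOfNumNodesEq.1 T.2
    rw [numNodes_leftComb]
    simp [this]
  · simp [numNodes_leftComb]
  · refine Set.disjoint_left.2 fun j hj hj' => ?_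
    obtain rfl : j = 0 := exposed_leftComb_subset _ hj
    rcases hj' with (⟨-, h, -⟩ | h) | ⟨i, -, h⟩
    · have h1 := BinaryTree.mem_treesOfNumNodesEq.1 T.2
      rw [h] at h1
      simp at h1
    · exact h.elim
    · simp at h
  · rw [Finset.mem_coe, mem_redPairs]
    exact numNodes_leftComb _
  · simp only [RedPair.mk.injEq, BinaryTree.node.injEq, true_and] at h
    exact Subtype.ext h

theorem tendsto_div_card_redPairs :
    Tendsto (fun n : ℕ => (2 * n + 1 : ℝ) / (redPairs n).card) atTop (𝓝 0) := by
  have h0 : |(1 / 2 : ℝ)| < 1 := by norm_num [abs_of_pos]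
  -- For size `n` the bound is `(2 * n + 1) / 2 ^ (n - 2) = 8 * n / 2 ^ n + 4 / 2 ^ n`.
  have h1 := (tendsto_pow_const_mul_const_pow_of_abs_lt_one 1 h0).const_mul 8
  have h2 := (tendsto_pow_const_mul_const_pow_of_abs_lt_one 0 h0).const_mul 4
  have h3 := h1.add h2
  simp only [mul_zero, add_zero] at h3
  refine squeeze_zero' (Eventually.of_forall fun n => by positivity) ?_ h3
  filter_upwards [eventually_ge_atTop 2] with n hn
  obtain ⟨n, rfl⟩ := Nat.exists_eq_add_of_le' hn
  have h4 : (2 : ℝ) ^ n ≤ (redPairs (n + 2)).card := by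
    exact_mod_cast two_pow_le_card_redPairs n
  calc (2 * (n + 2 : ℕ) + 1 : ℝ) / (redPairs (n + 2)).card
      ≤ (2 * (n + 2 : ℕ) + 1 : ℝ) / 2 ^ n := by gcongr
    _ = _ := by
      rw [one_div, inv_pow, pow_add]
      field_simp
      ring

/-! ### Counting unordered tuples -/

theorem card_finset_sym {α : Type*} [DecidableEq α] (s : Finset α) (k : ℕ) :
    (s.sym k).card = s.card.multichoose k := by
  have : s.sym k = (Finset.univ : Finset (Sym s k)).image (Sym.map Subtype.val) := by
    ext m
    rw [Finset.mem_sym_iff]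
    simp only [Finset.mem_image, Finset.mem_univ, true_and]
    constructor
    · intro h
      refine ⟨m.attach.map fun x => ⟨x.1, h x.1 x.2⟩, ?_⟩
      rw [Sym.map_map]
      exact Sym.attach_map_coe m
    · rintro ⟨m, rfl⟩ a ha
      obtain ⟨b, -, rfl⟩ := Sym.mem_map.1 ha
      exact b.2
  rw [this, Finset.card_image_of_injective _ (Sym.map_injective Subtype.val_injective k),
    Finset.card_univ, Sym.card_sym_eq_multichoose, Fintype.card_coe]

theorem multichoose_le_pow (n k : ℕ) : n.multichoose k ≤ n ^ k := by
  induction k generalizing n with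
  | zero => simp
  | succ k ihk =>
    induction n with
    | zero => simp
    | succ n ihn =>
      rw [Nat.multichoose_succ_succ]
      have h1 : n ^ (k + 1) ≤ n * (n + 1) ^ k := by
        rw [pow_succ']
        gcongr
        omega
      have h2 := ihk (n + 1)
      rw [pow_succ', add_one_mul]
      omega

theorem pow_le_factorial_mul_multichoose (n k : ℕ) :
    n ^ k ≤ k.factorial * n.multichoose k := by
  rw [Nat.multichoose_eq, ← Nat.descFactorial_eq_factorial_mul_choose]
  rcases Nat.eq_zero_or_pos k with rfl | hk
  · simp
  · have := (n + k - 1).pow_sub_le_descFactorial k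
    rwa [show n + k - 1 + 1 - k = n by omega] at this

/-- The tuples with all components of size exactly `n` already suffice; `k ≠ 0` ensures that the
maximum is attained. -/
theorem pow_le_factorial_mul_ncard_sphMax {k : ℕ} (hk : k ≠ 0) (n : ℕ) :
    (redPairs n).card ^ k ≤ k.factorial * (sphMax k n).ncard := by
  classical
  refine (pow_le_factorial_mul_multichoose _ k).trans (Nat.mul_le_mul_left _ ?_)
  rw [← card_finset_sym, ← Set.ncard_coe_finset]
  refine Set.ncard_le_ncard (fun s hs => ?_) (finite_sphMax k n)
  rw [Finset.mem_coe, Finset.mem_sym_iff] at hs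
  obtain ⟨k, rfl⟩ := Nat.exists_eq_succ_of_ne_zero hk
  obtain ⟨t, ht⟩ := s.exists_mem
  refine ⟨⟨t, ht, mem_redPairs.1 (hs t ht)⟩, ?_⟩
  rintro _ ⟨u, hu, rfl⟩
  exact (mem_redPairs.1 (hs u hu)).le

theorem card_redPairs_pos {n : ℕ} (hn : 2 ≤ n) : 0 < (redPairs n).card := by
  obtain ⟨n, rfl⟩ := Nat.exists_eq_add_of_le' hn
  exact (pow_pos two_pos n).trans_le (two_pow_le_card_redPairs n)

theorem ncard_sphMax_pos {k n : ℕ} (hk : k ≠ 0) (hn : 2 ≤ n) : 0 < (sphMax k n).ncard :=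
  Nat.pos_of_mul_pos_left
    ((pow_pos (card_redPairs_pos hn) k).trans_le (pow_le_factorial_mul_ncard_sphMax hk n))

/-! ### Tuples generating an infinite cyclic group -/

theorem exists_mem_zpowers_of_mem_tuplesGenerating {k : ℕ} {s : X k}
    (hs : s ∈ tuplesGenerating k (Multiplicative ℤ)) :
    ∃ g : F, ∀ t ∈ s, RedPair.toF t ∈ Subgroup.zpowers g := by
  obtain ⟨e⟩ := hs
  have : IsCyclic (generated s) := isCyclic_of_surjective e.symm e.symm.surjective
  obtain ⟨g, hg⟩ := IsCyclic.exists_generator (α := generated s)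
  refine ⟨g, fun t ht => ?_⟩
  obtain ⟨i, hi⟩ := hg ⟨t.toF, Subgroup.subset_closure ⟨t, ht, rfl⟩⟩
  exact ⟨i, by simpa using congrArg Subtype.val hi⟩

/-- Single out a component `t` of size `n`; the other `k` components are cyclic partners of `t.toF`,
which is nontrivial because `n ≥ 2`. -/
theorem ncard_tuplesGenerating_inter_sphMax_le (k : ℕ) {n : ℕ} (hn : 2 ≤ n) :
    (tuplesGenerating (k + 1) (Multiplicative ℤ) ∩ sphMax (k + 1) n).ncard ≤
      (redPairs n).card * (2 * n + 1) ^ k := by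
  classical
  have hfin : ∀ f, (cyclicPartners f n).Finite := fun f =>
    (finite_size_le n).subset fun u hu => hu.1
  have hsub : tuplesGenerating (k + 1) (Multiplicative ℤ) ∩ sphMax (k + 1) n ⊆
      ⋃ t ∈ redPairs n, (((hfin t.toF).toFinset.sym k).image (Sym.cons t) : Set (X (k + 1))) := by
    rintro s ⟨hs, ⟨t, ht, htn⟩, hmax⟩
    obtain ⟨g, hg⟩ := exists_mem_zpowers_of_mem_tuplesGenerating hs
    obtain ⟨s', rfl⟩ := Sym.exists_cons_of_mem ht
    refine Set.mem_biUnion (Finset.mem_coe.2 (mem_redPairs.2 htn)) ?_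
    refine Finset.mem_coe.2 (Finset.mem_image_of_mem _ (Finset.mem_sym_iff.2 fun u hu => ?_))
    have hu' : u ∈ t ::ₛ s' := Sym.mem_cons_of_mem hu
    rw [Set.Finite.mem_toFinset]
    exact ⟨hmax ⟨u, hu', rfl⟩, g, hg t ht, hg u hu'⟩
  refine (Set.ncard_le_ncard hsub
    ((redPairs n).finite_toSet.biUnion fun t _ => Finset.finite_toSet _)).trans ?_
  refine (Finset.set_ncard_biUnion_le _ _).trans ?_
  rw [← smul_eq_mul]
  refine Finset.sum_le_card_nsmul _ _ _ fun t ht => ?_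
  rw [Set.ncard_coe_finset]
  refine Finset.card_image_le.trans ?_
  rw [card_finset_sym, ← Set.ncard_eq_toFinset_card _ (hfin t.toF)]
  refine (multichoose_le_pow _ _).trans (Nat.pow_le_pow_left (ncard_cyclicPartners_le ?_ n) k)
  exact RedPair.toF_ne_one (by rwa [mem_redPairs.1 ht])

theorem hasDensity_tuplesGenerating_int_zero {k : ℕ} (hk : 2 ≤ k) :
    HasDensity k (tuplesGenerating k (Multiplicative ℤ)) 0 := by
  obtain ⟨k, rfl⟩ := Nat.exists_eq_add_of_le' hk
  have h := ((tendsto_div_card_redPairs.pow (k + 1)).const_mul ((k + 2).factorial : ℝ))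
  rw [zero_pow k.succ_ne_zero, mul_zero] at h
  refine squeeze_zero' (Eventually.of_forall fun n => by positivity) ?_ h
  filter_upwards [eventually_ge_atTop 2] with n hn
  have hr : (0 : ℝ) < (redPairs n).card := by exact_mod_cast card_redPairs_pos hn
  have hs : (0 : ℝ) < (sphMax (k + 2) n).ncard := by
    exact_mod_cast ncard_sphMax_pos (k + 1).succ_ne_zero hn
  have h1 : ((tuplesGenerating (k + 2) (Multiplicative ℤ) ∩ sphMax (k + 2) n).ncard : ℝ) ≤
      (redPairs n).card * (2 * n + 1) ^ (k + 1) := by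
    exact_mod_cast ncard_tuplesGenerating_inter_sphMax_le (k + 1) hn
  have h2 : ((redPairs n).card : ℝ) ^ (k + 2) ≤ (k + 2).factorial * (sphMax (k + 2) n).ncard := by
    exact_mod_cast pow_le_factorial_mul_ncard_sphMax (k + 1).succ_ne_zero n
  -- Cross-multiplying allows both counting bounds to be used without dividing.
  rw [div_pow, mul_div_assoc', div_le_div_iff₀ hs (by positivity)]
  calc _ ≤ ((redPairs n).card * (2 * n + 1) ^ (k + 1)) * ((redPairs n).card : ℝ) ^ (k + 1) := by
        gcongr
    _ = (2 * n + 1) ^ (k + 1) * ((redPairs n).card : ℝ) ^ (k + 2) := by ring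
    _ ≤ (2 * n + 1) ^ (k + 1) * ((k + 2).factorial * (sphMax (k + 2) n).ncard) := by gcongr
    _ = _ := by ring

/-- A nontrivial element of a torsion-free group generates an infinite cyclic group. Size `1` is
excluded since it represents the identity. -/
theorem sphMax_one_subset_tuplesGenerating {n : ℕ} (hn : 2 ≤ n) :
    sphMax 1 n ⊆ tuplesGenerating 1 (Multiplicative ℤ) := by
  rintro s ⟨⟨t, ht, htn⟩, -⟩
  have hgen : generated s = Subgroup.zpowers t.toF := by
    obtain ⟨s', rfl⟩ := Sym.exists_cons_of_mem ht
    rw [generated, Subgroup.zpowers_eq_closure]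
    congr 1
    ext f
    have : s' = Sym.nil := Subsingleton.elim _ _
    simp [this, eq_comm]
  have hinf : Infinite (generated s) := by
    rw [hgen]
    exact (infinite_zpowers.2 (not_isOfFinOrder_of_isMulTorsionFree
      (RedPair.toF_ne_one (htn ▸ hn)))).to_subtype
  have hcyc : IsCyclic (generated s) := by
    rw [hgen]
    infer_instance
  exact ⟨intCyclicMulEquiv.symm⟩

theorem hasDensity_tuplesGenerating_one_int :
    HasDensity 1 (tuplesGenerating 1 (Multiplicative ℤ)) 1 := by
  refine tendsto_const_nhds.congr' ?_
  filter_upwards [eventually_ge_atTop 2] with n hn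
  rw [Set.inter_eq_right.2 (sphMax_one_subset_tuplesGenerating hn), div_self]
  exact_mod_cast (ncard_sphMax_pos one_ne_zero hn).ne'

/-! ### Isomorphism classes and the spectrum -/

theorem isoClass_eq_iff {H K : Type} [Group H] [Group K] :
    isoClass H = isoClass K ↔ Nonempty (H ≃* K) := by
  constructor
  · intro h
    obtain ⟨e⟩ := Quotient.exact h
    exact ⟨e.groupIsoToMulEquiv⟩
  · rintro ⟨e⟩
    exact Quotient.sound ⟨e.toGrpIso⟩

theorem tuplesGenerating_congr {H K : Type} [Group H] [Group K] (e : H ≃* K) (k : ℕ) :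
    tuplesGenerating k H = tuplesGenerating k K := by
  ext s
  exact ⟨fun ⟨f⟩ => ⟨f.trans e⟩, fun ⟨f⟩ => ⟨f.trans e.symm⟩⟩

/-- The spectrum contains only classes of subgroups of `F`, so membership of `ℤ` requires a copy of
it inside `F`. -/
theorem exists_subgroup_mulEquiv_int : ∃ H : Subgroup F, Nonempty (H ≃* Multiplicative ℤ) := by
  obtain ⟨s, hs⟩ := Set.nonempty_of_ncard_ne_zero (ncard_sphMax_pos one_ne_zero le_rfl).ne'
  exact ⟨generated s, sphMax_one_subset_tuplesGenerating le_rfl hs⟩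

theorem specMax_one : specMax 1 = {isoClass (Multiplicative ℤ)} := by
  ext c
  rw [Set.mem_singleton_iff]
  constructor
  · rintro ⟨H, rfl, d, hd, hdens⟩
    by_contra hne
    rw [isoClass_eq_iff] at hne
    -- From `n = 2` on, every tuple of the sphere generates a copy of `ℤ`, so none generates a copy
    -- of `H`; uniqueness of limits then rules out a positive density.
    have h0 : HasDensity 1 (tuplesGenerating 1 H) 0 := by
      refine tendsto_const_nhds.congr' ?_
      filter_upwards [eventually_ge_atTop 2] with n hn
      have : tuplesGenerating 1 H ∩ sphMax 1 n = ∅ := by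
        refine Set.eq_empty_of_forall_notMem ?_
        rintro s ⟨⟨e⟩, hs⟩
        obtain ⟨e'⟩ := sphMax_one_subset_tuplesGenerating hn hs
        exact hne ⟨e.symm.trans e'⟩
      rw [this, Set.ncard_empty, Nat.cast_zero, zero_div]
    exact hd.ne (tendsto_nhds_unique h0 hdens)
  · rintro rfl
    obtain ⟨H, ⟨e⟩⟩ := exists_subgroup_mulEquiv_int
    refine ⟨H, isoClass_eq_iff.2 ⟨e⟩, 1, one_pos, ?_⟩
    rw [tuplesGenerating_congr e]
    exact hasDensity_tuplesGenerating_one_int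

theorem isoClass_int_notMem_specMax {k : ℕ} (hk : 2 ≤ k) :
    isoClass (Multiplicative ℤ) ∉ specMax k := by
  rintro ⟨H, hH, d, hd, hdens⟩
  obtain ⟨e⟩ := isoClass_eq_iff.1 hH
  rw [tuplesGenerating_congr e] at hdens
  exact hd.ne (tendsto_nhds_unique (hasDensity_tuplesGenerating_int_zero hk) hdens)

end ThompsonF

end

theorem mainTheorem3 :
    ThompsonF.specMax 1 = {ThompsonF.isoClass (Multiplicative ℤ)} ∧
      ∀ k : ℕ, 2 ≤ k →
        ThompsonF.isoClass (Multiplicative ℤ) ∉ ThompsonF.specMax k ∧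
          ThompsonF.HasDensity k (ThompsonF.tuplesGenerating k (Multiplicative ℤ)) 0 :=
  ⟨ThompsonF.specMax_one, fun _ hk => ⟨ThompsonF.isoClass_int_notMem_specMax hk,
    ThompsonF.hasDensity_tuplesGenerating_int_zero hk⟩⟩
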